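/- Let $d\ge 0$ be an integer. A density on $\mathbb{R}^d$ is a Lebesgue measurable function $f:\mathbb{R}^d\to[0,\infty)$ with $\int_{\mathbb{R}^d} f(x)\,dx=1$. It is called log-concave if $\log f:\mathbb{R}^d\to[-\infty,\infty)$ is concave, where $\log 0=-\infty$. Let $(f_n)$ be a sequence of log-concave densities on $\mathbb{R}^d$ and let $f$ be a density on $\mathbb{R}^d$ such that $f_n\to f$ in distribution, that is, $\int g(x)f_n(x)\,dx\to\int g(x)f(x)\,dx$ for every bounded continuous function $g:\mathbb{R}^d\to\mathbb{R}$. Let $\|\cdot\|$ denote the Euclidean norm. Then: (a) $f$ is log-concave, in the sense that $f$ is equal Lebesgue-almost everywhere to a log-concave density; (b) $f_n(x)\to f(x)$ for Lebesgue-almost every $x\in\mathbb{R}^d$; (c) if $a_0>0$ and $b_0\in\mathbb{R}$ are such that $f(x)\le e^{-a_0\|x\|+b_0}$ for Lebesgue-almost every $x\in\mathbb{R}^d$, then for every real $a<a_0$, $$\int_{\mathbb{R}^d}e^{a\|x\|}\,|f_n(x)-f(x)|\,dx\to 0,$$ and, if $f$ is continuous, also $$\sup_{x\in\mathbb{R}^d}e^{a\|x\|}\,|f_n(x)-f(x)|\to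 0.$$ (For finitely many $n$ the integral and the supremum may be equal to $+\infty$.) -/

import Mathlib

open MeasureTheory Filter Topology

/-- A (Lebesgue) probability density on `ℝ^d`: a nonnegative Lebesgue measurable function with
integral one. -/
structure IsDensity {d : ℕ} (f : EuclideanSpace ℝ (Fin d) → ℝ) : Prop where
  nonneg : ∀ x, 0 ≤ f x
  integrable : Integrable f volume
  integral_eq_one : ∫ x, f x = 1

/-- A log-concave density: a density `f` such that `log f`, regarded as a function with values in
`[-∞, ∞)`, is concave. Equivalently, the effective domain `{x | 0 < f x}` of `log f` is convex and
`log f` is concave there; `ConcaveOn` includes the convexity of the set. -/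
structure IsLogConcaveDensity {d : ℕ} (f : EuclideanSpace ℝ (Fin d) → ℝ) : Prop
    extends IsDensity f where
  concaveOn_log : ConcaveOn ℝ {x | 0 < f x} (fun x => Real.log (f x))

/-- Convergence in distribution of the measures with densities `fₙ` to the one with density `f`. -/
def ConvergesInDistribution {d : ℕ} (fn : ℕ → EuclideanSpace ℝ (Fin d) → ℝ)
    (f : EuclideanSpace ℝ (Fin d) → ℝ) : Prop :=
  ∀ g : BoundedContinuousFunction (EuclideanSpace ℝ (Fin d)) ℝ,
    Tendsto (fun n => ∫ x, g x * fn n x) atTop (𝓝 (∫ x, g x * f x))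

/-! Log-concavity turns weak information into pointwise information. The points near which `f` has
mass are not contained in any proper affine subspace, so a nondegenerate simplex has such points as
vertices. Weak convergence gives points near these vertices where `fn n` is bounded below, and
log-concavity spreads the bound over a fixed ball (`eventualPosSet_nonempty`).

A value `K` of `fn n` at any point then propagates along the cone towards that ball
(`exp_le_of_ball`). Hence too large a value creates too much mass; this yields a uniform bound,
locally uniform upper bounds, and vanishing of `f` off the closure of the open convex set
`eventualPosSet fn`. On that set, `log fn` is concave and locally bounded, so the `fn n` are locally
equi-Lipschitz and weak convergence becomes pointwise. The frontier of a convex set is null, which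
gives (a) and (b).

For (c), a drop of `log fn` between a centre and a large sphere persists along rays by concavity, so
the `fn n` share an exponential majorant. Dominated convergence, or locally uniform convergence plus
a tail estimate, concludes. -/

open Metric Set

variable {d : ℕ} {fn : ℕ → EuclideanSpace ℝ (Fin d) → ℝ} {f : EuclideanSpace ℝ (Fin d) → ℝ}

/-! ### Tent test functions -/

/-- The tent function of radius `ρ` around `x`, used as a test function for weak convergence. -/
noncomputable def tent {d : ℕ} (x : EuclideanSpace ℝ (Fin d)) (ρ : ℝ) :
    BoundedContinuousFunction (EuclideanSpace ℝ (Fin d)) ℝ :=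
  BoundedContinuousFunction.ofNormedAddCommGroup (fun y => max 0 (ρ - dist y x))
    (by fun_prop) |ρ| (fun y => by
      rw [Real.norm_of_nonneg (le_max_left _ _)]
      exact max_le (abs_nonneg _) ((sub_le_self _ dist_nonneg).trans (le_abs_self _)))

theorem tent_nonneg (x y : EuclideanSpace ℝ (Fin d)) (ρ : ℝ) : 0 ≤ tent x ρ y :=
  le_max_left _ _

theorem tent_pos {x y : EuclideanSpace ℝ (Fin d)} {ρ : ℝ} (h : y ∈ ball x ρ) :
    0 < tent x ρ y :=
  lt_max_of_lt_right (sub_pos.2 h)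

theorem tent_eq_zero {x y : EuclideanSpace ℝ (Fin d)} {ρ : ℝ} (h : y ∉ ball x ρ) :
    tent x ρ y = 0 :=
  max_eq_left (sub_nonpos.2 (not_lt.1 h))

theorem integrable_tent (x : EuclideanSpace ℝ (Fin d)) (ρ : ℝ) : Integrable (tent x ρ) := by
  refine (tent x ρ).continuous.integrable_of_hasCompactSupport ?_
  refine HasCompactSupport.of_support_subset_isCompact (isCompact_closedBall x ρ) fun y hy => ?_
  by_contra h
  exact hy (tent_eq_zero fun h' => h (ball_subset_closedBall h'))

theorem integral_tent_pos (x : EuclideanSpace ℝ (Fin d)) {ρ : ℝ} (hρ : 0 < ρ) :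
    0 < ∫ y, tent x ρ y :=
  integral_pos_of_integrable_nonneg_nonzero (x := x) (tent x ρ).continuous (integrable_tent x ρ)
    (fun y => tent_nonneg x y ρ) (tent_pos (mem_ball_self hρ)).ne'

theorem integrable_tent_mul {h : EuclideanSpace ℝ (Fin d) → ℝ} (hh : Integrable h)
    (x : EuclideanSpace ℝ (Fin d)) (ρ : ℝ) : Integrable (fun y => tent x ρ y * h y) :=
  hh.bdd_mul (tent x ρ).continuous.aestronglyMeasurable
    (ae_of_all _ fun y => (tent x ρ).norm_coe_le_norm y)

theorem le_integral_tent_mul {h : EuclideanSpace ℝ (Fin d) → ℝ} (hh : Integrable h)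
    {x : EuclideanSpace ℝ (Fin d)} {ρ B : ℝ} (hB : ∀ᵐ y, y ∈ ball x ρ → B ≤ h y) :
    B * ∫ y, tent x ρ y ≤ ∫ y, tent x ρ y * h y := by
  rw [← integral_const_mul]
  refine integral_mono_ae ((integrable_tent x ρ).const_mul B) (integrable_tent_mul hh x ρ) ?_
  filter_upwards [hB] with y hy
  by_cases hm : y ∈ ball x ρ
  · simpa [mul_comm] using mul_le_mul_of_nonneg_right (hy hm) (tent_nonneg x y ρ)
  · simp [tent_eq_zero hm]

theorem integral_tent_mul_le {h : EuclideanSpace ℝ (Fin d) → ℝ} (hh : Integrable h)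
    {x : EuclideanSpace ℝ (Fin d)} {ρ B : ℝ} (hB : ∀ᵐ y, y ∈ ball x ρ → h y ≤ B) :
    ∫ y, tent x ρ y * h y ≤ B * ∫ y, tent x ρ y := by
  have := le_integral_tent_mul hh.neg (x := x) (ρ := ρ) (B := -B)
    (hB.mono fun y hy hm => neg_le_neg (hy hm))
  simp only [Pi.neg_apply, mul_neg, integral_neg, neg_mul] at this
  linarith

theorem exists_lt_of_lt_integral_tent_mul {h : EuclideanSpace ℝ (Fin d) → ℝ} (hh : Integrable h)
    {x : EuclideanSpace ℝ (Fin d)} {ρ B : ℝ}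
    (hB : B * ∫ y, tent x ρ y < ∫ y, tent x ρ y * h y) : ∃ y ∈ ball x ρ, B < h y := by
  by_contra! hcon
  exact hB.not_ge (integral_tent_mul_le hh (ae_of_all _ hcon))

theorem exists_gt_of_integral_tent_mul_lt {h : EuclideanSpace ℝ (Fin d) → ℝ} (hh : Integrable h)
    {x : EuclideanSpace ℝ (Fin d)} {ρ B : ℝ}
    (hB : ∫ y, tent x ρ y * h y < B * ∫ y, tent x ρ y) : ∃ y ∈ ball x ρ, h y < B := by
  by_contra! hcon
  exact hB.not_ge (le_integral_tent_mul hh (ae_of_all _ hcon))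

theorem IsDensity.ae_eq_zero_of_integral_tent_mul_nonpos {f : EuclideanSpace ℝ (Fin d) → ℝ}
    (hf : IsDensity f) {x : EuclideanSpace ℝ (Fin d)} {ρ : ℝ}
    (h : ∫ y, tent x ρ y * f y ≤ 0) : ∀ᵐ y, y ∈ ball x ρ → f y = 0 := by
  have h0 : 0 ≤ fun y => tent x ρ y * f y := fun y => mul_nonneg (tent_nonneg x y ρ) (hf.nonneg y)
  have := (integral_eq_zero_iff_of_nonneg h0 (integrable_tent_mul hf.integrable x ρ)).1
    (h.antisymm (integral_nonneg h0))
  filter_upwards [this] with y hy hm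
  exact (mul_eq_zero.1 hy).resolve_left (tent_pos hm).ne'

/-! ### Propagation of lower bounds by log-concavity -/

theorem IsLogConcaveDensity.exp_le {h : EuclideanSpace ℝ (Fin d) → ℝ}
    (hh : IsLogConcaveDensity h) {x y : EuclideanSpace ℝ (Fin d)} {K c t : ℝ} (hK : 0 < K)
    (hc : 0 < c) (hx : K ≤ h x) (hy : c ≤ h y) (h0 : 0 ≤ t) (h1 : t ≤ 1) :
    Real.exp ((1 - t) * Real.log K + t * Real.log c) ≤ h ((1 - t) • x + t • y) := by
  have hx' : x ∈ {x | 0 < h x} := hK.trans_le hx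
  have hy' : y ∈ {x | 0 < h x} := hc.trans_le hy
  have hm : 0 < h ((1 - t) • x + t • y) :=
    hh.concaveOn_log.1 hx' hy' (sub_nonneg.2 h1) h0 (by ring)
  have := hh.concaveOn_log.2 hx' hy' (sub_nonneg.2 h1) h0 (by ring)
  rw [← Real.le_log_iff_exp_le hm]
  refine le_trans ?_ this
  simp only [smul_eq_mul]
  have := Real.log_le_log hK hx
  have := Real.log_le_log hc hy
  have : 0 ≤ 1 - t := sub_nonneg.2 h1
  gcongr

theorem IsLogConcaveDensity.convex_superlevel {h : EuclideanSpace ℝ (Fin d) → ℝ}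
    (hh : IsLogConcaveDensity h) {c : ℝ} (hc : 0 < c) : Convex ℝ {x | c ≤ h x} := by
  intro x hx y hy a b ha hb hab
  obtain rfl : a = 1 - b := by linarith
  have := hh.exp_le hc hc hx hy hb (by linarith)
  rwa [show (1 - b) * Real.log c + b * Real.log c = Real.log c by ring, Real.exp_log hc] at this

/-- A lower bound on a ball and a lower bound at a point near `x` give a lower bound on a ball
around each point between `x` and the centre of the first ball. -/
theorem IsLogConcaveDensity.exp_le_of_ball {h : EuclideanSpace ℝ (Fin d) → ℝ}
    (hh : IsLogConcaveDensity h) {x x' y₀ w : EuclideanSpace ℝ (Fin d)} {K c t r : ℝ} (hK : 0 < K)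
    (hc : 0 < c) (hx : K ≤ h x') (hy : ∀ y ∈ ball y₀ r, c ≤ h y) (h0 : 0 < t) (h1 : t ≤ 1)
    (hxx : x' ∈ ball x (t * r / 2)) (hw : w ∈ ball ((1 - t) • x + t • y₀) (t * r / 2)) :
    Real.exp ((1 - t) * Real.log K + t * Real.log c) ≤ h w := by
  -- `y` is the point with `w = (1 - t) • x' + t • y`. The errors of `x'` and `w` are each below `t
  -- * r / 2`, so after division by `t` they keep `y` within `r` of `y₀`.
  set y := t⁻¹ • (w - (1 - t) • x') with hy_def
  have hwy : w = (1 - t) • x' + t • y := by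
    rw [hy_def, smul_inv_smul₀ h0.ne']; abel
  rw [hwy]
  refine hh.exp_le hK hc hx (hy y ?_) h0.le h1
  have e : y - y₀ = t⁻¹ • ((w - ((1 - t) • x + t • y₀)) - (1 - t) • (x' - x)) := by
    rw [← inv_smul_smul₀ h0.ne' (y - y₀), smul_sub t, hy_def, smul_inv_smul₀ h0.ne']
    congr 1
    module
  rw [mem_ball_iff_norm] at hxx hw ⊢
  rw [e, norm_smul, Real.norm_of_nonneg (inv_nonneg.2 h0.le), inv_mul_lt_iff₀ h0]
  refine (norm_sub_le _ _).trans_lt ?_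
  have : ‖(1 - t) • (x' - x)‖ ≤ ‖x' - x‖ := by
    rw [norm_smul, Real.norm_of_nonneg (sub_nonneg.2 h1)]
    exact mul_le_of_le_one_left (norm_nonneg _) (by linarith)
  linarith

/-- If `ball z R` lies in the convex hull of `s`, and each point of `s` is moved by less than
`R / 3`, then `ball z (R / 3)` lies in every closed convex set containing the moved points. -/
theorem ball_subset_of_perturbation {s C : Set (EuclideanSpace ℝ (Fin d))}
    {z : EuclideanSpace ℝ (Fin d)} {R : ℝ} (hR : 0 < R) (hs : ball z R ⊆ convexHull ℝ s)
    (hC : Convex ℝ C) (hC' : IsClosed C) (h : ∀ x ∈ s, ∃ y ∈ C, dist y x < R / 3) :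
    ball z (R / 3) ⊆ C := by
  intro w hw
  by_contra hwC
  obtain ⟨φ, u, hu, huw⟩ := geometric_hahn_banach_closed_point hC hC' hwC
  obtain ⟨v, rfl⟩ := (InnerProductSpace.toDual ℝ (EuclideanSpace ℝ (Fin d))).surjective φ
  simp only [InnerProductSpace.toDual_apply_apply] at hu huw
  have hsub : convexHull ℝ s ⊆ {x | inner ℝ v x ≤ u + ‖v‖ * (R / 3)} := by
    refine convexHull_min (fun x hx => ?_)
      (convex_halfSpace_le (innerₛₗ ℝ v).isLinear _)
    obtain ⟨y, hyC, hy⟩ := h x hx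
    have h1 : inner ℝ v (x - y) ≤ ‖v‖ * (R / 3) := by
      refine (real_inner_le_norm _ _).trans ?_
      gcongr
      rw [← dist_eq_norm, dist_comm]
      exact hy.le
    rw [inner_sub_right] at h1
    have := hu y hyC
    simp only [mem_ofPred_eq]
    linarith
  rcases eq_or_ne v 0 with rfl | hv
  · have := hsub (hs (mem_ball_self hR))
    simp at this huw
    linarith
  have hv' : 0 < ‖v‖ := norm_pos_iff.2 hv
  -- Moving `w` by `R / 3` in the normal direction stays in `ball z R` but leaves the half-space
  -- relaxed by `‖v‖ * (R / 3)`.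
  have hmem : w + (R / 3 / ‖v‖) • v ∈ ball z R := by
    rw [mem_ball_iff_norm] at hw ⊢
    have : ‖(R / 3 / ‖v‖) • v‖ = R / 3 := by
      rw [norm_smul, Real.norm_of_nonneg (by positivity), div_mul_cancel₀ _ hv'.ne']
    calc ‖w + (R / 3 / ‖v‖) • v - z‖ = ‖(w - z) + (R / 3 / ‖v‖) • v‖ := by congr 1; abel
      _ ≤ ‖w - z‖ + ‖(R / 3 / ‖v‖) • v‖ := norm_add_le _ _
      _ < R := by linarith
  have := hsub (hs hmem)
  simp only [mem_ofPred_eq, inner_add_right, inner_smul_right, real_inner_self_eq_norm_sq] at this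
  have e : R / 3 / ‖v‖ * ‖v‖ ^ 2 = ‖v‖ * (R / 3) := by field_simp
  linarith

/-! ### The region of eventual positivity -/

/-- The points near which the functions `fn n` are eventually bounded below by a positive
constant. -/
def eventualPosSet (fn : ℕ → EuclideanSpace ℝ (Fin d) → ℝ) : Set (EuclideanSpace ℝ (Fin d)) :=
  {x | ∃ r > 0, ∃ c > 0, ∀ᶠ n in atTop, ∀ y ∈ ball x r, c ≤ fn n y}

theorem isOpen_eventualPosSet : IsOpen (eventualPosSet fn) := by
  refine isOpen_iff.2 fun x ⟨r, hr, c, hc, h⟩ => ⟨r / 2, half_pos hr, fun y hy => ?_⟩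
  refine ⟨r / 2, half_pos hr, c, hc, h.mono fun n hn z hz => hn z ?_⟩
  exact ball_subset_ball' (by rw [mem_ball] at hy; linarith) hz

theorem convex_eventualPosSet (hfn : ∀ n, IsLogConcaveDensity (fn n)) :
    Convex ℝ (eventualPosSet fn) := by
  rintro x ⟨r, hr, c, hc, hx⟩ y ⟨r', hr', c', hc', hy⟩ a b ha hb hab
  refine ⟨min r r', lt_min hr hr', min c c', lt_min hc hc', ?_⟩
  filter_upwards [hx, hy] with n hnx hny z hz
  have e : z = a • (x + (z - (a • x + b • y))) + b • (y + (z - (a • x + b • y))) := by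
    obtain rfl : a = 1 - b := by linarith
    module
  rw [mem_ball_iff_norm] at hz
  rw [e]
  refine (hfn n).convex_superlevel (lt_min hc hc') ?_ ?_ ha hb hab
  · exact (min_le_left _ _).trans (hnx _ (by simpa using hz.trans_le (min_le_left _ _)))
  · exact (min_le_right _ _).trans (hny _ (by simpa using hz.trans_le (min_le_right _ _)))

theorem ConvergesInDistribution.exists_eventually_exists_le
    (hconv : ConvergesInDistribution fn f) (hfn : ∀ n, IsLogConcaveDensity (fn n))
    {x : EuclideanSpace ℝ (Fin d)} {ρ : ℝ} (hρ : 0 < ρ) (h : 0 < ∫ y, tent x ρ y * f y) :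
    ∃ η > 0, ∀ᶠ n in atTop, ∃ y ∈ ball x ρ, η ≤ fn n y := by
  have hI := integral_tent_pos x hρ
  refine ⟨(∫ y, tent x ρ y * f y) / 2 / ∫ y, tent x ρ y, by positivity, ?_⟩
  filter_upwards [(hconv (tent x ρ)).eventually_const_lt (half_lt_self h)] with n hn
  rw [← div_mul_cancel₀ ((∫ y, tent x ρ y * f y) / 2) hI.ne'] at hn
  obtain ⟨y, hy, hlt⟩ := exists_lt_of_lt_integral_tent_mul (hfn n).integrable hn
  exact ⟨y, hy, hlt.le⟩

/-- A proper affine subspace is null, and `f` vanishes a.e. locally off the set; otherwise `f` would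
have integral zero. -/
theorem IsDensity.affineSpan_eq_top (hf : IsDensity f) :
    affineSpan ℝ {x | ∀ ρ > 0, 0 < ∫ y, tent x ρ y * f y} = ⊤ := by
  set T := {x | ∀ ρ > 0, 0 < ∫ y, tent x ρ y * f y} with hT
  by_contra hne
  have h1 : volume T = 0 :=
    measure_mono_null (subset_affineSpan ℝ T) (Measure.addHaar_affineSubspace _ _ hne)
  have h2 : volume (Tᶜ ∩ {x | f x ≠ 0}) = 0 := by
    refine measure_null_of_locally_null _ fun x hx => ?_
    have hx1 : ∃ ρ > 0, ∫ y, tent x ρ y * f y ≤ 0 := by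
      by_contra! hcon
      exact hx.1 hcon
    obtain ⟨ρ, hρ, hle⟩ := hx1
    refine ⟨ball x ρ ∩ (Tᶜ ∩ {x | f x ≠ 0}), 
      inter_mem (mem_nhdsWithin_of_mem_nhds (ball_mem_nhds x hρ)) self_mem_nhdsWithin, ?_⟩
    · have := hf.ae_eq_zero_of_integral_tent_mul_nonpos hle
      refine measure_mono_null (fun y hy => ?_) this
      exact fun h => hy.2.2 (h hy.1)
  have h3 : f =ᵐ[volume] 0 := by
    refine measure_mono_null (fun x hx => ?_) (measure_union_null h1 h2)
    by_cases hxT : x ∈ T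
    · exact Or.inl hxT
    · exact Or.inr ⟨hxT, hx⟩
  have := hf.integral_eq_one
  rw [integral_congr_ae h3] at this
  simp at this

theorem ConvergesInDistribution.eventualPosSet_nonempty
    (hconv : ConvergesInDistribution fn f) (hfn : ∀ n, IsLogConcaveDensity (fn n))
    (hf : IsDensity f) : (eventualPosSet fn).Nonempty := by
  obtain ⟨s, hsT, b, hb⟩ := AffineBasis.exists_affine_subbasis hf.affineSpan_eq_top
  have hfin : Finite s := finite_set_of_fin_dim_affineIndependent ℝ (hb ▸ b.ind)
  have hint : (interior (convexHull ℝ s)).Nonempty := by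
    rw [interior_convexHull_nonempty_iff_affineSpan_eq_top]
    have := b.tot
    rwa [hb, Subtype.range_coe] at this
  obtain ⟨z, hz⟩ := hint
  obtain ⟨R, hR, hball⟩ := Metric.mem_nhds_iff.1 (mem_interior_iff_mem_nhds.1 hz)
  have key : ∀ x : s, ∃ η > 0, ∀ᶠ n in atTop, ∃ y ∈ ball (x : EuclideanSpace ℝ (Fin d)) (R / 3),
      η ≤ fn n y := fun x =>
    hconv.exists_eventually_exists_le hfn (by positivity) (hsT x.2 _ (by positivity))
  choose η hη hev using key
  obtain ⟨c, hc, hcη⟩ : ∃ c > 0, ∀ x, c ≤ η x := by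
    have : ∀ᶠ c in 𝓝[>] (0 : ℝ), ∀ x, c ≤ η x :=
      eventually_all.2 fun x => nhdsWithin_le_nhds (eventually_le_nhds (hη x))
    obtain ⟨c, h1, h2⟩ := (this.and self_mem_nhdsWithin).exists
    exact ⟨c, h2, h1⟩
  refine ⟨z, R / 3, by positivity, c, hc, ?_⟩
  filter_upwards [eventually_all.2 hev] with n hn
  choose y hy hyη using hn
  have hsub : convexHull ℝ (range y) ⊆ {w | c ≤ fn n w} := by
    refine convexHull_min ?_ ((hfn n).convex_superlevel hc)
    rintro _ ⟨x, rfl⟩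
    exact (hcη x).trans (hyη x)
  refine (ball_subset_of_perturbation hR hball (convex_convexHull ℝ (range y))
    ((finite_range y).isClosed_convexHull ℝ) fun x hx => ?_).trans hsub
  exact ⟨y ⟨x, hx⟩, subset_convexHull ℝ _ (mem_range_self _), hy ⟨x, hx⟩⟩

theorem tendsto_segment (x y : EuclideanSpace ℝ (Fin d)) :
    Tendsto (fun t : ℝ => (1 - t) • x + t • y) (𝓝[>] 0) (𝓝 x) := by
  have : Continuous fun t : ℝ => (1 - t) • x + t • y := by fun_prop
  exact (this.tendsto' 0 x (by simp)).mono_left nhdsWithin_le_nhds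

theorem ConvergesInDistribution.ae_eq_zero_of_notMem_closure
    (hconv : ConvergesInDistribution fn f) (hfn : ∀ n, IsLogConcaveDensity (fn n))
    (hf : IsDensity f) {x : EuclideanSpace ℝ (Fin d)} (hx : x ∉ closure (eventualPosSet fn)) :
    ∃ ρ > 0, ∀ᵐ y, y ∈ ball x ρ → f y = 0 := by
  by_contra hcon
  have hT : ∀ ρ > 0, 0 < ∫ y, tent x ρ y * f y := fun ρ hρ => by
    by_contra! hle
    exact hcon ⟨ρ, hρ, hf.ae_eq_zero_of_integral_tent_mul_nonpos hle⟩
  obtain ⟨y₀, r, hr, c, hc, hy₀⟩ := hconv.eventualPosSet_nonempty hfn hf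
  -- Mass of `f` near `x` would put every point of the segment towards `y₀`, except possibly `x`,
  -- into `eventualPosSet fn`.
  refine hx (mem_closure_of_tendsto (tendsto_segment x y₀) ?_)
  filter_upwards [Ioc_mem_nhdsGT (zero_lt_one' ℝ)] with t ht
  have htr : 0 < t * r / 2 := by have := ht.1; positivity
  obtain ⟨η, hη, hev⟩ := hconv.exists_eventually_exists_le hfn htr (hT _ htr)
  refine ⟨t * r / 2, htr, Real.exp ((1 - t) * Real.log η + t * Real.log c), Real.exp_pos _, ?_⟩
  filter_upwards [hev, hy₀] with n hn hn₀ w hw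
  obtain ⟨x', hx', hηx'⟩ := hn
  exact (hfn n).exp_le_of_ball hη hc hηx' hn₀ ht.1 ht.2 hx' hw

/-! ### Upper bounds -/

/-- If `f` is essentially at most `B` near `x`, then `fn n` is eventually less than any `K > B`,
locally uniformly near `x`. -/
theorem ConvergesInDistribution.eventually_lt
    (hconv : ConvergesInDistribution fn f) (hfn : ∀ n, IsLogConcaveDensity (fn n))
    (hf : IsDensity f) {x : EuclideanSpace ℝ (Fin d)} {B K : ℝ}
    (hB : ∃ ρ > 0, ∀ᵐ y, y ∈ ball x ρ → f y ≤ B) (hK : 0 < K) (hBK : B < K) :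
    ∀ᶠ p in atTop ×ˢ 𝓝 x, fn p.1 p.2 < K := by
  obtain ⟨y₀, r, hr, c, hc, hy₀⟩ := hconv.eventualPosSet_nonempty hfn hf
  obtain ⟨ρ, hρ, hB⟩ := hB
  by_contra hfreq
  have hcont : Continuous fun t : ℝ => Real.exp ((1 - t) * Real.log K + t * Real.log c) := by
    fun_prop
  -- For small `t` the bound propagated from `K` near `x` and `c` near `y₀` still exceeds `B`; a
  -- tent at the intermediate point then contradicts weak convergence.
  have hlim := (hcont.tendsto' 0 K (by simp [Real.exp_log hK])).mono_left
    (nhdsWithin_le_nhds (s := Ioi 0))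
  obtain ⟨t, ht, htz, htK⟩ := ((show ∀ᶠ t in 𝓝[>] (0 : ℝ), t ∈ Ioc 0 1 from
    Ioc_mem_nhdsGT zero_lt_one).and
    (((tendsto_segment x y₀).eventually (ball_mem_nhds x hρ)).and
      (hlim.eventually_const_lt hBK))).exists
  have htr : 0 < t * r / 2 := by have := ht.1; positivity
  obtain ⟨δ, hδ, hsub⟩ := Metric.isOpen_ball.mem_nhds htz |> Metric.mem_nhds_iff.1
  set z := (1 - t) • x + t • y₀ with hz
  set σ := min δ (t * r / 2) with hσ
  have hσ0 : 0 < σ := lt_min hδ htr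
  have hI := integral_tent_pos z hσ0
  have hle : ∫ y, tent z σ y * f y ≤ B * ∫ y, tent z σ y :=
    integral_tent_mul_le hf.integrable
      (hB.mono fun y hy hm => hy (hsub (ball_subset_ball (min_le_left _ _) hm)))
  have hev := (hconv (tent z σ)).eventually_lt_const
    (hle.trans_lt (mul_lt_mul_of_pos_right htK hI))
  refine hfreq ?_
  filter_upwards [(hev.and hy₀).prod_mk (ball_mem_nhds x htr)] with p hp
  obtain ⟨⟨h1, h2⟩, h3⟩ := hp
  by_contra! hKp
  refine h1.not_ge (le_integral_tent_mul (hfn p.1).integrable (ae_of_all _ fun w hw => ?_))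
  exact (hfn p.1).exp_le_of_ball hK hc hKp h2 ht.1 ht.2 h3
    (ball_subset_ball (min_le_right _ _) hw)

theorem ConvergesInDistribution.eventually_le_const
    (hconv : ConvergesInDistribution fn f) (hfn : ∀ n, IsLogConcaveDensity (fn n))
    (hf : IsDensity f) : ∃ M > 0, ∀ᶠ n in atTop, ∀ x, fn n x ≤ M := by
  obtain ⟨y₀, r, hr, c, hc, hy₀⟩ := hconv.eventualPosSet_nonempty hfn hf
  set V := volume.real (ball (0 : EuclideanSpace ℝ (Fin d)) (r / 4)) with hV
  have hV0 : 0 < V := 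
    ENNReal.toReal_pos (measure_ball_pos _ _ (by positivity)).ne' measure_ball_lt_top.ne
  -- Chosen so that the geometric mean of `M` and `c` is `Real.exp 1 / V`: on a ball of volume `V`
  -- this gives mass at least `e > 1`.
  set M := Real.exp (2 * (1 - Real.log V - Real.log c / 2)) with hM
  refine ⟨M, Real.exp_pos _, hy₀.mono fun n hn x => ?_⟩
  by_contra! hlt
  set z := (1 - (1 / 2 : ℝ)) • x + (1 / 2 : ℝ) • y₀ with hz
  have hlow : ∀ w ∈ ball z (1 / 2 * r / 2), Real.exp 1 / V ≤ fn n w := fun w hw => by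
    have := (hfn n).exp_le_of_ball (Real.exp_pos _) hc hlt.le hn one_half_pos (by norm_num)
      (mem_ball_self (by positivity)) hw
    rwa [Real.log_exp, show (1 - 1 / 2) * (2 * (1 - Real.log V - Real.log c / 2))
      + 1 / 2 * Real.log c = 1 - Real.log V by ring, Real.exp_sub, Real.exp_log hV0] at this
  have h1 : ∫ _ in ball z (1 / 2 * r / 2), Real.exp 1 / V ≤ ∫ w in ball z (1 / 2 * r / 2), fn n w :=
    setIntegral_mono_on (integrableOn_const measure_ball_lt_top.ne)
      (hfn n).integrable.integrableOn measurableSet_ball hlow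
  have h2 : ∫ w in ball z (1 / 2 * r / 2), fn n w ≤ ∫ w, fn n w :=
    setIntegral_le_integral (hfn n).integrable (ae_of_all _ (hfn n).nonneg)
  have h3 : volume.real (ball z (1 / 2 * r / 2)) = V := by
    rw [hV, Measure.real, Measure.addHaar_ball_center, show 1 / 2 * r / 2 = r / 4 by ring]
    rfl
  rw [setIntegral_const, h3, smul_eq_mul, mul_div_cancel₀ _ hV0.ne'] at h1
  rw [(hfn n).integral_eq_one] at h2
  have := Real.add_one_lt_exp one_ne_zero
  linarith

/-! ### Equicontinuity and pointwise limits -/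

theorem sub_le_mul_abs_log_sub_log {u v M : ℝ} (hu : 0 < u) (hv : 0 < v) (huM : u ≤ M) :
    u - v ≤ M * |Real.log u - Real.log v| := by
  have h := Real.log_le_sub_one_of_pos (div_pos hv hu)
  rw [Real.log_div hv.ne' hu.ne', le_sub_iff_add_le, le_div_iff₀ hu] at h
  have h1 : u - v ≤ u * (Real.log u - Real.log v) := by linarith
  exact h1.trans ((mul_le_mul_of_nonneg_left (le_abs_self _) hu.le).trans
    (mul_le_mul_of_nonneg_right huM (abs_nonneg _)))

/-- Near a point of `eventualPosSet fn`, the functions `fn n` are eventually uniformly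
Lipschitz. -/
theorem ConvergesInDistribution.exists_lipschitz
    (hconv : ConvergesInDistribution fn f) (hfn : ∀ n, IsLogConcaveDensity (fn n))
    (hf : IsDensity f) {x : EuclideanSpace ℝ (Fin d)} (hx : x ∈ eventualPosSet fn) :
    ∃ L ≥ 0, ∃ r > 0, ∀ᶠ n in atTop, ∀ y ∈ ball x r, ∀ z ∈ ball x r,
      fn n y - fn n z ≤ L * dist y z := by
  obtain ⟨r, hr, c, hc, hx⟩ := hx
  obtain ⟨M, hM, hle⟩ := hconv.eventually_le_const hfn hf
  set K := (2 * max |Real.log c| |Real.log M| / (r / 2)).toNNReal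
  refine ⟨M * K, by positivity, r - r / 2, by linarith, ?_⟩
  filter_upwards [hx, hle] with n hxn hMn y hy z hz
  have hpos : ∀ w ∈ ball x r, 0 < fn n w := fun w hw => hc.trans_le (hxn w hw)
  have hsub : ball x (r - r / 2) ⊆ ball x r := ball_subset_ball (by linarith)
  have hlip := ((hfn n).concaveOn_log.subset hpos (convex_ball x r)).lipschitzOnWith_of_abs_le
    (half_pos hr) (M := max |Real.log c| |Real.log M|) (fun w hw => by
      have h1 := Real.log_le_log hc (hxn w hw)
      have h2 := Real.log_le_log (hpos w hw) (hMn w)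
      exact abs_le_max_abs_abs h1 h2)
  refine (sub_le_mul_abs_log_sub_log (hpos y (hsub hy)) (hpos z (hsub hz)) (hMn y)).trans ?_
  rw [mul_assoc]
  exact mul_le_mul_of_nonneg_left (hlip.dist_le_mul y hy z hz) hM.le

/-- Near a point of `eventualPosSet fn`, the functions `fn n` are eventually within `ε` of the
weighted averages of `f` over small balls. -/
theorem ConvergesInDistribution.eventually_average
    (hconv : ConvergesInDistribution fn f) (hfn : ∀ n, IsLogConcaveDensity (fn n))
    (hf : IsDensity f) {x : EuclideanSpace ℝ (Fin d)} (hx : x ∈ eventualPosSet fn)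
    {ε : ℝ} (hε : 0 < ε) :
    ∀ᶠ ρ in 𝓝[>] 0, ∀ᶠ n in atTop, ∀ y ∈ ball x ρ,
      |fn n y - (∫ w, tent x ρ w * f w) / ∫ w, tent x ρ w| < ε := by
  obtain ⟨L, hL, r, hr, hlip⟩ := hconv.exists_lipschitz hfn hf hx
  have hlim : Tendsto (fun ρ : ℝ => L * (2 * ρ)) (𝓝[>] 0) (𝓝 0) := by
    have : Continuous fun ρ : ℝ => L * (2 * ρ) := by fun_prop
    exact (this.tendsto' 0 0 (by simp)).mono_left nhdsWithin_le_nhds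
  filter_upwards [hlim.eventually_lt_const (half_pos hε), Ioo_mem_nhdsGT hr] with ρ hρL hρ
  have hI := integral_tent_pos x hρ.1
  set a := (∫ w, tent x ρ w * f w) / ∫ w, tent x ρ w with ha
  have hsub : ball x ρ ⊆ ball x r := ball_subset_ball hρ.2.le
  have e : ∫ w, tent x ρ w * f w = a * ∫ w, tent x ρ w := (div_mul_cancel₀ _ hI.ne').symm
  have h1 := (hconv (tent x ρ)).eventually_const_lt (u := (a - ε / 2) * ∫ w, tent x ρ w)
    (by rw [e]; exact mul_lt_mul_of_pos_right (by linarith) hI)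
  have h2 := (hconv (tent x ρ)).eventually_lt_const (u := (a + ε / 2) * ∫ w, tent x ρ w)
    (by rw [e]; exact mul_lt_mul_of_pos_right (by linarith) hI)
  filter_upwards [hlip, h1, h2] with n hn h1n h2n y hy
  obtain ⟨w₁, hw₁, hlt₁⟩ := exists_lt_of_lt_integral_tent_mul (hfn n).integrable h1n
  obtain ⟨w₂, hw₂, hlt₂⟩ := exists_gt_of_integral_tent_mul_lt (hfn n).integrable h2n
  have hdist : ∀ w ∈ ball x ρ, ∀ w' ∈ ball x ρ, fn n w - fn n w' < ε / 2 := fun w hw w' hw' => by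
    refine (hn w (hsub hw) w' (hsub hw')).trans_lt (lt_of_le_of_lt ?_ hρL)
    have := dist_triangle_right w w' x
    rw [mem_ball] at hw hw'
    exact mul_le_mul_of_nonneg_left (by linarith) hL
  have := hdist _ hw₁ _ hy
  have := hdist _ hy _ hw₂
  rw [abs_lt]
  constructor <;> linarith

theorem ConvergesInDistribution.exists_tendsto
    (hconv : ConvergesInDistribution fn f) (hfn : ∀ n, IsLogConcaveDensity (fn n))
    (hf : IsDensity f) {x : EuclideanSpace ℝ (Fin d)} (hx : x ∈ eventualPosSet fn) :
    ∃ l > 0, Tendsto (fun n => fn n x) atTop (𝓝 l) := by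
  have hc : CauchySeq fun n => fn n x := by
    refine Metric.cauchySeq_iff'.2 fun ε hε => ?_
    -- The averages of `f` do not depend on `n`, so closeness to them makes the sequence Cauchy.
    obtain ⟨ρ, hev, hρ⟩ :=
      ((hconv.eventually_average hfn hf hx (half_pos hε)).and self_mem_nhdsWithin).exists
    obtain ⟨N, hN⟩ := eventually_atTop.1 hev
    refine ⟨N, fun n hn => ?_⟩
    have h1 := hN n hn x (mem_ball_self hρ)
    have h2 := hN N le_rfl x (mem_ball_self hρ)
    rw [abs_lt] at h1 h2
    rw [Real.dist_eq, abs_lt]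
    constructor <;> linarith [h1.1, h1.2, h2.1, h2.2]
  obtain ⟨l, hl⟩ := cauchySeq_tendsto_of_complete hc
  obtain ⟨r, hr, c, hc, hx⟩ := hx
  exact ⟨l, hc.trans_le (ge_of_tendsto hl (hx.mono fun n hn => hn x (mem_ball_self hr))), hl⟩

/-- If `f` is essentially at least `B` near a point `x` of `eventualPosSet fn`, then `fn n` is
eventually greater than any `K < B`, locally uniformly near `x`. -/
theorem ConvergesInDistribution.eventually_gt
    (hconv : ConvergesInDistribution fn f) (hfn : ∀ n, IsLogConcaveDensity (fn n))
    (hf : IsDensity f) {x : EuclideanSpace ℝ (Fin d)} (hx : x ∈ eventualPosSet fn) {B K : ℝ}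
    (hB : ∃ ρ > 0, ∀ᵐ y, y ∈ ball x ρ → B ≤ f y) (hKB : K < B) :
    ∀ᶠ p in atTop ×ˢ 𝓝 x, K < fn p.1 p.2 := by
  obtain ⟨δ, hδ, hB⟩ := hB
  obtain ⟨ρ, hev, hρ⟩ := ((hconv.eventually_average hfn hf hx (sub_pos.2 hKB)).and
    (Ioo_mem_nhdsGT hδ)).exists
  have hI := integral_tent_pos x hρ.1
  have hle : B ≤ (∫ w, tent x ρ w * f w) / ∫ w, tent x ρ w := (le_div_iff₀ hI).2
    (le_integral_tent_mul hf.integrable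
      (hB.mono fun y hy hm => hy (ball_subset_ball hρ.2.le hm)))
  filter_upwards [hev.prod_mk (ball_mem_nhds x hρ.1)] with p hp
  have := (abs_lt.1 (hp.1 p.2 hp.2)).1
  linarith

/-- The limit is a log-concave density, and convergence takes place off the frontier of a convex
set. -/
theorem ConvergesInDistribution.exists_isLogConcaveDensity
    (hconv : ConvergesInDistribution fn f) (hfn : ∀ n, IsLogConcaveDensity (fn n))
    (hf : IsDensity f) : ∃ g : EuclideanSpace ℝ (Fin d) → ℝ, IsLogConcaveDensity g ∧
      f =ᵐ[volume] g ∧ ∀ᵐ x, Tendsto (fun n => fn n x) atTop (𝓝 (g x)) := by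
  classical
  -- Setting `g = 0` off `eventualPosSet fn` makes its positivity set exactly convex, not just up to
  -- a null set.
  have hex : ∀ x, ∃ l, (x ∈ eventualPosSet fn → 0 < l ∧ Tendsto (fun n => fn n x) atTop (𝓝 l)) ∧
      (x ∉ eventualPosSet fn → l = 0) := fun x => by
    by_cases hx : x ∈ eventualPosSet fn
    · obtain ⟨l, hl, h⟩ := hconv.exists_tendsto hfn hf hx
      exact ⟨l, fun _ => ⟨hl, h⟩, fun h => absurd hx h⟩
    · exact ⟨0, fun h => absurd h hx, fun _ => rfl⟩
  choose g hgpos hgzero using hex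
  have hset : {x | 0 < g x} = eventualPosSet fn := by
    ext x
    refine ⟨fun h => ?_, fun h => (hgpos x h).1⟩
    by_contra hx
    exact (lt_of_lt_of_eq h (hgzero x hx)).false
  have hg0 : ∀ x, 0 ≤ g x := fun x => by
    by_cases hx : x ∈ eventualPosSet fn
    · exact (hgpos x hx).1.le
    · exact (hgzero x hx).ge
  have hlim : ∀ᵐ x, Tendsto (fun n => fn n x) atTop (𝓝 (g x)) := by
    have hfr := (convex_eventualPosSet hfn).addHaar_frontier volume
    filter_upwards [measure_eq_zero_iff_ae_notMem.1 hfr] with x hx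
    by_cases hxA : x ∈ eventualPosSet fn
    · exact (hgpos x hxA).2
    · rw [hgzero x hxA]
      rw [isOpen_eventualPosSet.frontier_eq] at hx
      obtain ⟨ρ, hρ, hae⟩ :=
        hconv.ae_eq_zero_of_notMem_closure hfn hf fun h => hx ⟨h, hxA⟩
      refine tendsto_order.2 ⟨fun a ha => Eventually.of_forall fun n =>
        ha.trans_le ((hfn n).nonneg x), fun a ha => ?_⟩
      have := hconv.eventually_lt hfn hf ⟨ρ, hρ, hae.mono fun y hy hm => (hy hm).le⟩ ha ha
      exact (this.curry).mono fun n hn => hn.self_of_nhds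
  have hmeas : AEStronglyMeasurable g volume :=
    aestronglyMeasurable_of_tendsto_ae atTop
      (fun n => (hfn n).integrable.aestronglyMeasurable) hlim
  obtain ⟨M, hM, hle⟩ := hconv.eventually_le_const hfn hf
  have hgM : ∀ᵐ x, ‖g x‖ ≤ M := hlim.mono fun x hx => by
    rw [Real.norm_of_nonneg (hg0 x)]
    exact le_of_tendsto hx (hle.mono fun n hn => hn x)
  have hfg : f =ᵐ[volume] g := by
    refine ae_eq_of_integral_contDiff_smul_eq hf.integrable.locallyIntegrable ?_ ?_
    · exact (locallyIntegrable_const M).mono hmeas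
        (hgM.mono fun x hx => hx.trans (le_abs_self M))
    · intro φ hφ hφc
      simp only [smul_eq_mul]
      obtain ⟨C, hC⟩ := hφc.exists_bound_of_continuous hφ.continuous
      refine tendsto_nhds_unique (hconv (BoundedContinuousFunction.ofNormedAddCommGroup φ
        hφ.continuous C hC)) ?_
      refine tendsto_integral_filter_of_dominated_convergence (fun x => ‖φ x‖ * M)
        (Eventually.of_forall fun n => ?_) (hle.mono fun n hn => ae_of_all _ fun x => ?_) ?_ ?_
      · exact hφ.continuous.aestronglyMeasurable.mul (hfn n).integrable.aestronglyMeasurable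
      · rw [norm_mul, Real.norm_of_nonneg ((hfn n).nonneg x)]
        exact mul_le_mul_of_nonneg_left (hn x) (norm_nonneg _)
      · exact (hφ.continuous.integrable_of_hasCompactSupport hφc).norm.mul_const M
      · exact hlim.mono fun x hx => hx.const_mul (φ x)
  refine ⟨g, ⟨⟨hg0, hf.integrable.congr hfg, ?_⟩, ?_⟩, hfg, hlim⟩
  · rw [← integral_congr_ae hfg, hf.integral_eq_one]
  · rw [hset]
    refine ⟨convex_eventualPosSet hfn, fun x hx y hy a b ha hb hab => ?_⟩
    have hz := convex_eventualPosSet hfn hx hy ha hb hab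
    have hlog : ∀ w ∈ eventualPosSet fn,
        Tendsto (fun n => Real.log (fn n w)) atTop (𝓝 (Real.log (g w))) := fun w hw =>
      (hgpos w hw).2.log (hgpos w hw).1.ne'
    refine le_of_tendsto_of_tendsto (((hlog x hx).const_smul a).add ((hlog y hy).const_smul b))
      (hlog _ hz) ?_
    filter_upwards [(hgpos x hx).2.eventually_const_lt (hgpos x hx).1,
      (hgpos y hy).2.eventually_const_lt (hgpos y hy).1] with n hnx hny
    exact (hfn n).concaveOn_log.2 hnx hny ha hb hab

/-! ### Uniform exponential decay -/

theorem ConvergesInDistribution.eventually_lt_of_continuous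
    (hconv : ConvergesInDistribution fn f) (hfn : ∀ n, IsLogConcaveDensity (fn n))
    (hf : IsDensity f) {B : EuclideanSpace ℝ (Fin d) → ℝ} (hB : Continuous B)
    (hfB : ∀ᵐ x, f x ≤ B x) {x : EuclideanSpace ℝ (Fin d)} {K : ℝ} (hK : 0 < K) (hBK : B x < K) :
    ∀ᶠ p in atTop ×ˢ 𝓝 x, fn p.1 p.2 < K := by
  obtain ⟨B', hB', hK'⟩ := exists_between hBK
  obtain ⟨ρ, hρ, hsub⟩ := Metric.mem_nhds_iff.1 (hB.continuousAt.eventually_lt_const hB')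
  exact hconv.eventually_lt hfn hf
    ⟨ρ, hρ, hfB.mono fun y hy hm => hy.trans (hsub hm : B y < B').le⟩ hK hK'

theorem eventually_forall_of_isCompact {X Y : Type*} [TopologicalSpace Y] {l : Filter X}
    {C : Set Y} (hC : IsCompact C) {P : X → Y → Prop}
    (h : ∀ y ∈ C, ∀ᶠ p in l ×ˢ 𝓝 y, P p.1 p.2) : ∀ᶠ x in l, ∀ y ∈ C, P x y := by
  have h' : ∀ᶠ p in l ×ˢ 𝓝ˢ C, P p.1 p.2 := hC.mem_prod_nhdsSet_of_forall h
  exact h'.curry.mono fun x hx y hy => hx.self_of_nhdsSet y hy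

/-- An exponential bound on the limit gives eventually a uniform exponential bound with any
smaller rate. -/
theorem ConvergesInDistribution.exists_eventually_le_exp
    (hconv : ConvergesInDistribution fn f) (hfn : ∀ n, IsLogConcaveDensity (fn n))
    (hf : IsDensity f) {a₀ b₀ a : ℝ} (ha : 0 < a) (haa : a < a₀)
    (hB : ∀ᵐ x, f x ≤ Real.exp (-a₀ * ‖x‖ + b₀)) :
    ∃ b, ∀ᶠ n in atTop, ∀ x, fn n x ≤ Real.exp (-a * ‖x‖ + b) := by
  obtain ⟨y₀, r, hr, c, hc, hy₀⟩ := hconv.eventualPosSet_nonempty hfn hf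
  obtain ⟨M, hM, hle⟩ := hconv.eventually_le_const hfn hf
  -- Since `a < a₀`, a large sphere forces `log fn` to drop by more than `a * R` below `log c`, a
  -- lower bound for it at the centre.
  obtain ⟨R, hR, hRc⟩ : ∃ R > 0, -a₀ * (R - ‖y₀‖) + b₀ < -a * R + Real.log c := by
    refine ⟨max 1 ((a₀ * ‖y₀‖ + b₀ - Real.log c) / (a₀ - a) + 1), by positivity, ?_⟩
    have h1 : (a₀ * ‖y₀‖ + b₀ - Real.log c) / (a₀ - a) <
        max 1 ((a₀ * ‖y₀‖ + b₀ - Real.log c) / (a₀ - a) + 1) :=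
      (lt_add_one _).trans_le (le_max_right _ _)
    rw [div_lt_iff₀ (sub_pos.2 haa)] at h1
    linarith
  have hsph : ∀ᶠ n in atTop, ∀ x ∈ sphere y₀ R, fn n x < Real.exp (-a * R + Real.log c) := by
    refine eventually_forall_of_isCompact (isCompact_sphere y₀ R) fun x hx => ?_
    refine hconv.eventually_lt_of_continuous hfn hf (by fun_prop) hB (Real.exp_pos _)
      (Real.exp_lt_exp.2 (lt_of_le_of_lt ?_ hRc))
    have h1 : R - ‖y₀‖ ≤ ‖x‖ := by
      rw [mem_sphere_iff_norm] at hx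
      linarith [norm_sub_le x y₀]
    have : 0 < a₀ := ha.trans haa
    nlinarith
  refine ⟨Real.log M + a * R + a * ‖y₀‖, ?_⟩
  filter_upwards [hy₀, hle, hsph] with n hcn hMn hn x
  rcases ((hfn n).nonneg x).eq_or_lt with h0 | hpos
  · rw [← h0]; exact (Real.exp_pos _).le
  rw [← Real.log_le_iff_le_exp hpos]
  have hx : ‖x‖ ≤ ‖x - y₀‖ + ‖y₀‖ := by simpa using norm_add_le (x - y₀) y₀
  have hax := mul_le_mul_of_nonneg_left hx ha.le
  suffices Real.log (fn n x) ≤ Real.log M + a * R - a * ‖x - y₀‖ by linarith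
  set D := ‖x - y₀‖ with hD
  rcases lt_or_ge D R with hlt | hge
  · have := Real.log_le_log hpos (hMn x)
    have := mul_lt_mul_of_pos_left hlt ha
    linarith
  have hD0 : 0 < D := hR.trans_le hge
  have hc0 := hcn y₀ (mem_ball_self hr)
  have hp0 : 0 < fn n y₀ := hc.trans_le hc0
  have ht0 : 0 ≤ 1 - R / D := sub_nonneg.2 ((div_le_one hD0).2 hge)
  have ht1 : 1 - R / D ≤ 1 := sub_le_self _ (by positivity)
  have h1 := (hfn n).exp_le hpos hp0 le_rfl le_rfl ht0 ht1
  have hmem : (1 - (1 - R / D)) • x + (1 - R / D) • y₀ ∈ sphere y₀ R := by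
    rw [mem_sphere_iff_norm, show (1 - (1 - R / D)) • x + (1 - R / D) • y₀ - y₀
      = (R / D) • (x - y₀) by module, norm_smul, Real.norm_of_nonneg (by positivity), ← hD,
      div_mul_cancel₀ _ hD0.ne']
  -- The mean slope of `log fn` from `y₀` to the sphere is below `-a`; by concavity so is the one
  -- from `y₀` to `x`.
  have h2 := Real.exp_lt_exp.1 (h1.trans_lt (hn _ hmem))
  have h3 := Real.log_le_log hc hc0
  have h4 := Real.log_le_log hp0 (hMn y₀)
  have h5 : R / D * (Real.log (fn n x) - Real.log (fn n y₀) + a * D) < 0 := by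
    have : R / D * (a * D) = a * R := by field_simp
    linarith
  have h6 := (neg_of_mul_neg_right h5 (by positivity) :
    Real.log (fn n x) - Real.log (fn n y₀) + a * D < 0)
  have : 0 < a * R := mul_pos ha hR
  linarith

/-- The term of order `d + 1` in the exponential series gives comparison with `(1 + ‖x‖) ^ (-(d +
1))`, integrable in dimension `d`. -/
theorem integrable_exp_neg_mul_norm {k b : ℝ} (hk : 0 < k) :
    Integrable fun x : EuclideanSpace ℝ (Fin d) => Real.exp (-k * ‖x‖ + b) := by
  have h := (integrable_one_add_norm (E := EuclideanSpace ℝ (Fin d)) (μ := volume)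
    (r := (d + 1 : ℕ)) (by simp)).const_mul
      (Real.exp (k + b) * ((d + 1).factorial / k ^ (d + 1)))
  refine h.mono' (by fun_prop) (ae_of_all _ fun x => ?_)
  have hx : 0 < 1 + ‖x‖ := by positivity
  have h1 := Real.pow_div_factorial_le_exp (x := k * (1 + ‖x‖)) (by positivity) (d + 1)
  have hfac : (0 : ℝ) < (d + 1).factorial := by positivity
  rw [div_le_iff₀ hfac, mul_pow] at h1
  rw [Real.norm_of_nonneg (Real.exp_pos _).le, Real.rpow_neg hx.le, Real.rpow_natCast,
    show -k * ‖x‖ + b = (k + b) - k * (1 + ‖x‖) by ring, Real.exp_sub, mul_assoc,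
    div_eq_mul_inv]
  refine mul_le_mul_of_nonneg_left ?_ (Real.exp_pos _).le
  rw [inv_le_iff_one_le_mul₀ (Real.exp_pos _), div_mul_eq_mul_div, div_mul_eq_mul_div,
    le_div_iff₀ (by positivity), one_mul, mul_right_comm, ← div_eq_mul_inv,
    le_div_iff₀ (by positivity)]
  linarith

/-! ### Continuous limits and conclusion -/

/-- For continuous `f` the positivity set is open and lies in the closure of `eventualPosSet fn`; an
open convex set is the interior of its closure. -/
theorem ConvergesInDistribution.mem_eventualPosSet_of_continuous
    (hconv : ConvergesInDistribution fn f) (hfn : ∀ n, IsLogConcaveDensity (fn n))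
    (hf : IsDensity f) (hcont : Continuous f) {x : EuclideanSpace ℝ (Fin d)} (hx : 0 < f x) :
    x ∈ eventualPosSet fn := by
  have hsub : {y | 0 < f y} ⊆ closure (eventualPosSet fn) := fun y hy => by
    by_contra hcl
    obtain ⟨ρ, hρ, hae⟩ := hconv.ae_eq_zero_of_notMem_closure hfn hf hcl
    have := Measure.eqOn_open_of_ae_eq (μ := volume) (g := fun _ => 0)
      ((ae_restrict_iff' measurableSet_ball).2 hae)
      isOpen_ball hcont.continuousOn continuousOn_const (mem_ball_self hρ)
    exact (lt_of_lt_of_eq hy this).false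
  have hint : x ∈ interior (closure (eventualPosSet fn)) :=
    interior_maximal hsub (isOpen_lt continuous_const hcont) hx
  rwa [(convex_eventualPosSet hfn).interior_closure_eq_interior_of_nonempty_interior
    (by rw [isOpen_eventualPosSet.interior_eq]; exact hconv.eventualPosSet_nonempty hfn hf),
    isOpen_eventualPosSet.interior_eq] at hint

theorem ConvergesInDistribution.tendsto_prod_nhds
    (hconv : ConvergesInDistribution fn f) (hfn : ∀ n, IsLogConcaveDensity (fn n))
    (hf : IsDensity f) (hcont : Continuous f) (x : EuclideanSpace ℝ (Fin d)) :
    Tendsto (fun p : ℕ × EuclideanSpace ℝ (Fin d) => fn p.1 p.2) (atTop ×ˢ 𝓝 x) (𝓝 (f x)) := by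
  refine tendsto_order.2 ⟨fun K hK => ?_, fun K hK => ?_⟩
  · rcases (hf.nonneg x).eq_or_lt with h0 | hpos
    · exact Eventually.of_forall fun p => (hK.trans_eq h0.symm).trans_le ((hfn p.1).nonneg p.2)
    · obtain ⟨B, hB, hBx⟩ := exists_between hK
      obtain ⟨ρ, hρ, hsub⟩ := Metric.mem_nhds_iff.1 (hcont.continuousAt.eventually_const_lt hBx)
      exact hconv.eventually_gt hfn hf (hconv.mem_eventualPosSet_of_continuous hfn hf hcont hpos)
        ⟨ρ, hρ, ae_of_all _ fun y hy => (hsub hy : B < f y).le⟩ hB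
  · exact hconv.eventually_lt_of_continuous hfn hf hcont (ae_of_all _ fun _ => le_rfl)
      ((hf.nonneg x).trans_lt hK) hK

theorem exp_mul_abs_sub_le {u v a a' b s : ℝ} (hu : 0 ≤ u) (hv : 0 ≤ v)
    (hub : u ≤ Real.exp (-a' * s + b)) (hvb : v ≤ Real.exp (-a' * s + b)) :
    Real.exp (a * s) * |u - v| ≤ Real.exp (-(a' - a) * s + b) := by
  rw [show -(a' - a) * s + b = a * s + (-a' * s + b) by ring, Real.exp_add (a * s)]
  exact mul_le_mul_of_nonneg_left (abs_le.2 ⟨by linarith, by linarith⟩) (Real.exp_pos _).le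

theorem proposition2 (d : ℕ) (fn : ℕ → EuclideanSpace ℝ (Fin d) → ℝ)
    (f : EuclideanSpace ℝ (Fin d) → ℝ)
    (hfn : ∀ n, IsLogConcaveDensity (fn n)) (hf : IsDensity f)
    (hconv : ConvergesInDistribution fn f) :
    (∃ g : EuclideanSpace ℝ (Fin d) → ℝ, IsLogConcaveDensity g ∧ f =ᵐ[volume] g) ∧
    (∀ᵐ x ∂volume, Tendsto (fun n => fn n x) atTop (𝓝 (f x))) ∧
    (∀ a₀ b₀ : ℝ, 0 < a₀ → (∀ᵐ x ∂volume, f x ≤ Real.exp (-a₀ * ‖x‖ + b₀)) →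
      ∀ a : ℝ, a < a₀ →
        Tendsto (fun n => ∫⁻ x, ENNReal.ofReal (Real.exp (a * ‖x‖) * |fn n x - f x|))
          atTop (𝓝 0) ∧
        (Continuous f →
          Tendsto (fun n => ⨆ x, ENNReal.ofReal (Real.exp (a * ‖x‖) * |fn n x - f x|))
            atTop (𝓝 0))) := by
  obtain ⟨g, hg, hfg, hlim⟩ := hconv.exists_isLogConcaveDensity hfn hf
  have hlim' : ∀ᵐ x ∂volume, Tendsto (fun n => fn n x) atTop (𝓝 (f x)) := by
    filter_upwards [hfg, hlim] with x hx h
    rwa [hx]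
  refine ⟨⟨g, hg, hfg⟩, hlim', fun a₀ b₀ ha₀ hB a ha => ?_⟩
  -- Positivity of `a'` is needed for the uniform bound; `a' > a` leaves decay at rate `a' - a`.
  obtain ⟨a', haa', ha'⟩ := exists_between (max_lt ha ha₀)
  obtain ⟨b₁, hb₁⟩ := hconv.exists_eventually_le_exp hfn hf
    ((le_max_right a 0).trans_lt haa') ha' hB
  have hk : 0 < a' - a := sub_pos.2 ((le_max_left a 0).trans_lt haa')
  set b := max b₁ b₀
  have hbn : ∀ᶠ n in atTop, ∀ x, fn n x ≤ Real.exp (-a' * ‖x‖ + b) := hb₁.mono fun n hn x =>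
    (hn x).trans (Real.exp_le_exp.2 (add_le_add_right (le_max_left _ _) _))
  have hexp : ∀ x : EuclideanSpace ℝ (Fin d),
      Real.exp (-a₀ * ‖x‖ + b₀) ≤ Real.exp (-a' * ‖x‖ + b) := fun x =>
    Real.exp_le_exp.2 (add_le_add (mul_le_mul_of_nonneg_right (by linarith) (norm_nonneg x))
      (le_max_right _ _))
  have hfb : ∀ᵐ x ∂volume, f x ≤ Real.exp (-a' * ‖x‖ + b) := hB.mono fun x hx => hx.trans (hexp x)
  refine ⟨?_, fun hcont => ?_⟩
  · obtain ⟨N, hN⟩ := eventually_atTop.1 hbn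
    -- The majorant is only available from `N` on; earlier integrals may be infinite.
    refine (tendsto_add_atTop_iff_nat N).1 ?_
    rw [show (0 : ENNReal) = ∫⁻ _ : EuclideanSpace ℝ (Fin d), 0 by simp]
    refine tendsto_lintegral_of_dominated_convergence'
      (fun x => ENNReal.ofReal (Real.exp (-(a' - a) * ‖x‖ + b))) (fun n => ?_) (fun n => ?_) ?_ ?_
    · have h1 : AEMeasurable (fun x => fn (n + N) x - f x) volume :=
        (hfn _).integrable.aestronglyMeasurable.aemeasurable.sub
          hf.integrable.aestronglyMeasurable.aemeasurable
      have h2 : Measurable fun x : EuclideanSpace ℝ (Fin d) => Real.exp (a * ‖x‖) := by fun_prop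
      exact (h2.aemeasurable.mul h1.abs).ennreal_ofReal
    · filter_upwards [hfb] with x hx
      exact ENNReal.ofReal_le_ofReal (exp_mul_abs_sub_le ((hfn _).nonneg x) (hf.nonneg x)
        (hN _ (Nat.le_add_left _ _) x) hx)
    · exact (integrable_exp_neg_mul_norm hk).lintegral_lt_top.ne
    · filter_upwards [hlim'] with x hx
      have h1 := (((hx.sub_const (f x)).abs).const_mul (Real.exp (a * ‖x‖))).comp
        (tendsto_add_atTop_nat N)
      have h2 := ENNReal.tendsto_ofReal h1
      simpa using h2
  · have hfb' : ∀ x, f x ≤ Real.exp (-a' * ‖x‖ + b) := by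
      have hcl : IsClosed {x | f x ≤ Real.exp (-a' * ‖x‖ + b)} :=
        isClosed_le hcont (by fun_prop)
      intro x
      have := (Measure.dense_of_ae hfb).closure_eq
      rw [hcl.closure_eq] at this
      exact this.ge (mem_univ x)
    refine ENNReal.tendsto_nhds_zero.2 fun ε hε => ?_
    obtain ⟨δ, hδ, hδε⟩ := ENNReal.lt_iff_exists_nnreal_btwn.1 hε
    have hδ0 : (0 : ℝ) < δ := by exact_mod_cast hδ
    have htail : Tendsto (fun s : ℝ => Real.exp (-(a' - a) * s + b)) atTop (𝓝 0) :=
      Real.tendsto_exp_atBot.comp (tendsto_atBot_add_const_right _ _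
        (tendsto_id.const_mul_atTop_of_neg (neg_neg_of_pos hk)))
    obtain ⟨R, hR⟩ := eventually_atTop.1 (htail.eventually_le_const hδ0)
    -- Dividing by `Real.exp (|a| * R)` absorbs the weight on the ball for either sign of `a`.
    have hloc : ∀ᶠ n in atTop, ∀ x ∈ closedBall (0 : EuclideanSpace ℝ (Fin d)) R,
        |fn n x - f x| < δ / Real.exp (|a| * R) := by
      refine eventually_forall_of_isCompact (isCompact_closedBall _ _) fun x _ => ?_
      have h1 := ((hconv.tendsto_prod_nhds hfn hf hcont x).sub
        ((hcont.tendsto x).comp tendsto_snd)).abs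
      rw [sub_self, abs_zero] at h1
      exact h1.eventually_lt_const (by positivity)
    filter_upwards [hloc, hbn] with n hn hbn
    refine iSup_le fun x => le_trans ?_ hδε.le
    rw [← ENNReal.ofReal_coe_nnreal]
    refine ENNReal.ofReal_le_ofReal ?_
    rcases le_total R ‖x‖ with hx | hx
    · exact (exp_mul_abs_sub_le ((hfn _).nonneg x) (hf.nonneg x) (hbn x) (hfb' x)).trans (hR _ hx)
    · have h1 : a * ‖x‖ ≤ |a| * R :=
        mul_le_mul (le_abs_self a) hx (norm_nonneg x) (abs_nonneg a)
      have h2 := (hn x (by simpa using hx)).le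
      rw [le_div_iff₀ (Real.exp_pos _), mul_comm] at h2
      exact (mul_le_mul_of_nonneg_right (Real.exp_le_exp.2 h1) (abs_nonneg _)).trans h2
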